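/- **Proposition 1 (Batch GCS).** Let $\Theta$ be a finite set of $J=|\Theta|\ge 2$ hypotheses and $[n]$ a finite set of arms. A pull of arm $i$ under hypothesis $\theta$ gives a reward with law $\nu_i(\cdot;\theta)$ and mean $\mu_i(\theta)$; successive rewards are independent given the arms pulled. Let $\theta^*\in\Theta$ be the true hypothesis. Assume that for some $\eta>0$ all rewards, under every hypothesis, lie almost surely in $[-\sqrt\eta/2,\sqrt\eta/2]$, and that $$\eta_0:=\min_{i\in[n]}\min_{\theta\ne\theta'}(\mu_i(\theta)-\mu_i(\theta'))^2>0 .$$ For each $\theta$ let $\mathbf p_\theta$ be a maximizer of $\min_{\theta'\ne\theta}\sum_i p(i)(\mu_i(\theta')-\mu_i(\theta))^2$ over probability mass functions $\mathbf p$ on $[n]$, and put $$D_0:=\max_{\mathbf p}\min_{\theta'\ne\theta^*}\sum_{i}p(i)(\mu_i(\theta')-\mu_i(\theta^*))^2,\qquad D_1:=\min_{\theta\in\Theta}\min_{\theta'\ne\theta^*}\sum_{i}p_\theta(i)(\mu_i(\theta')-\mu_i(\theta^*))^2 .$$ Let $I_s,Y_s$ be the arm and the reward of round $s$, let $L_{Y^t}(\theta):=\sum_{s=1}^t(Y_s-\mu_{I_s}(\theta))^2$,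 and let $\hat\theta(t)$ be a minimizer of $L_{Y^t}$ over $\Theta$, ties being broken (possibly at random) without looking into the future. For a batch size $B\ge1$, Batch GCS draws the arms of rounds $1,\dots,B$ at random from a fixed initial distribution (for example the uniform one), and for $k\ge1$ draws the arms of rounds $kB+1,\dots,(k+1)B$ from $\mathbf p_{\hat\theta(kB)}$. For $\delta\in(0,1]$ let $\tau_\delta$ be the first $t\ge1$ with $$L_{Y^t}(\theta')-L_{Y^t}(\hat\theta(t))>\log(J/\delta)\quad\text{for all }\theta'\neq\hat\theta(t).$$ Then, with $C:=44+(\eta/\eta_0)^2$, $$\mathbb E[\tau_\delta]\le O\!\left(B+\frac{\eta\log C\,\log J}{D_1}+\frac{\log(J/\delta)}{D_0}+B\,J\,C^{1/\eta}\,\delta^{D_0/\eta^2}\right),$$ where the constant in $O(\cdot)$ is absolute. The same bound holds if the stopping test is made only at the ends of batches, i.e. for the first such $t$ that is a multiple of $B$. -/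

import Mathlib

open MeasureTheory
open scoped ENNReal

noncomputable section

namespace BatchGCS

variable {n : ℕ} {Θ : Type*} {Ω : Type*}

/-- The mean `μ_i(θ)` of the reward law `ν_i(· ; θ)` of arm `i` under hypothesis `θ`. -/
def mean (ν : Fin n → Θ → Measure ℝ) (i : Fin n) (θ : Θ) : ℝ := ∫ y, y ∂(ν i θ)

/-- `min_{θ' ≠ θ} ∑ i, w(i) (μ_i(θ') - μ_i(θ))²`, the objective of the verification problem for
`θ` (a minimum over a finite set, nonempty when there are at least two hypotheses). -/
def verifValue (m : Fin n → Θ → ℝ) (θ : Θ) (w : Fin n → ℝ) : ℝ :=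
  ⨅ θ' : {θ' : Θ // θ' ≠ θ}, ∑ i, w i * (m i θ' - m i θ) ^ 2

/-- `w` is a Chernoff verification proportion for `θ`: a probability mass function on the arms
that maximizes the verification objective among all of them. -/
def IsVerifProportion (m : Fin n → Θ → ℝ) (θ : Θ) (w : Fin n → ℝ) : Prop :=
  w ∈ stdSimplex ℝ (Fin n) ∧ ∀ w' ∈ stdSimplex ℝ (Fin n), verifValue m θ w' ≤ verifValue m θ w

/-- `D₀ = max_w min_{θ' ≠ θ*} ∑ i, w(i) (μ_i(θ') - μ_i(θ*))²`, over probability mass functions. -/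
def D₀ (m : Fin n → Θ → ℝ) (θs : Θ) : ℝ :=
  ⨆ w : stdSimplex ℝ (Fin n), verifValue m θs w

/-- `D₁ = min_θ min_{θ' ≠ θ*} ∑ i, p_θ(i) (μ_i(θ') - μ_i(θ*))²`, where `p θ` is the proportion
used for verifying `θ`; the outer minimum is over all hypotheses, `θ*` included. -/
def D₁ (m : Fin n → Θ → ℝ) (p : Θ → Fin n → ℝ) (θs : Θ) : ℝ :=
  ⨅ θ : Θ, verifValue m θs (p θ)

/-- `η₀ = min_i min_{θ ≠ θ'} (μ_i(θ) - μ_i(θ'))²`. -/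
def η₀ (m : Fin n → Θ → ℝ) : ℝ :=
  ⨅ i : Fin n, ⨅ x : {x : Θ × Θ // x.1 ≠ x.2}, (m i x.1.1 - m i x.1.2) ^ 2

/-- The constant `C = 44 + (η / η₀)²`. -/
def constC (η η₀ : ℝ) : ℝ := 44 + (η / η₀) ^ 2

/-- The threshold `β(J, δ) = log (J / δ)`. -/
def threshold (J : ℕ) (δ : ℝ) : ℝ := Real.log (J / δ)

/-- The sum of squared errors `L_{Y^t}(θ) = ∑_{s=1}^t (Y_s - μ_{I_s}(θ))²`. -/
def sqErr (m : Fin n → Θ → ℝ) (I : ℕ → Ω → Fin n) (Y : ℕ → Ω → ℝ) (t : ℕ) (ω : Ω) (θ : Θ) : ℝ :=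
  ∑ s ∈ Finset.Icc 1 t, (Y s ω - m (I s ω) θ) ^ 2

/-- The law from which Batch GCS draws the arm of round `t + 1`: in the first batch (rounds
`1, …, B`) the initial law `q`, and in rounds `k B + 1, …, (k + 1) B` with `k ≥ 1` the verification
proportion of the estimate `θ̂(k B)` at the end of the previous batch. -/
def samplingLaw (q : Fin n → ℝ) (p : Θ → Fin n → ℝ) (B : ℕ) (θhat : ℕ → Ω → Θ) (t : ℕ) (ω : Ω) :
    Fin n → ℝ :=
  if t < B then q else p (θhat (B * (t / B)) ω)

/-- `(I_t, Y_t)_{t ≥ 1}` with the estimates `θ̂(t)` is a run of Batch GCS (never stopped; the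
stopping times are read off it) with batch size `B`, initial law `q` and proportions `p`, in the
environment with reward laws `ν` and true hypothesis `θs`. The filtration `𝓕` contains the
history of arms and rewards, and the random bits used to break ties in the choice of `θ̂(t)`. -/
structure IsRun [mΩ : MeasurableSpace Ω] (ν : Fin n → Θ → Measure ℝ) (θs : Θ)
    (q : Fin n → ℝ) (p : Θ → Fin n → ℝ) (B : ℕ) (P : Measure Ω)
    (𝓕 : Filtration ℕ mΩ)
    (I : ℕ → Ω → Fin n) (Y : ℕ → Ω → ℝ) (θhat : ℕ → Ω → Θ) : Prop where
  arm_adapted : ∀ t, 1 ≤ t → ∀ i, MeasurableSet[𝓕 t] {ω | I t ω = i}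
  reward_adapted : ∀ t, 1 ≤ t → Measurable[𝓕 t] (Y t)
  estimate_adapted : ∀ t, 1 ≤ t → ∀ θ, MeasurableSet[𝓕 t] {ω | θhat t ω = θ}
  /-- `θ̂(t)` minimizes the sum of squared errors; ties are broken in any nonanticipating way. -/
  estimate_min : ∀ t, 1 ≤ t → ∀ᵐ ω ∂P, ∀ θ,
    sqErr (mean ν) I Y t ω (θhat t ω) ≤ sqErr (mean ν) I Y t ω θ
  /-- Given the past, `I_{t+1}` has the sampling law, and given also `I_{t+1} = i`, the reward
  `Y_{t+1}` has the law `ν_i(· ; θ*)`. -/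
  cond_law : ∀ (t : ℕ) (i : Fin n) (A : Set ℝ), MeasurableSet A →
    P[({ω | I (t + 1) ω = i ∧ Y (t + 1) ω ∈ A}).indicator (fun _ => (1 : ℝ)) | 𝓕 t]
      =ᵐ[P] fun ω => samplingLaw q p B θhat t ω i * (ν i θs).real A

/-- The stopping test at time `t`: every `θ' ≠ θ̂(t)` has a sum of squared errors that exceeds that
of `θ̂(t)` by more than the threshold. -/
def StopTest [Fintype Θ] (m : Fin n → Θ → ℝ) (δ : ℝ) (I : ℕ → Ω → Fin n) (Y : ℕ → Ω → ℝ)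
    (θhat : ℕ → Ω → Θ) (t : ℕ) (ω : Ω) : Prop :=
  ∀ θ', θ' ≠ θhat t ω →
    threshold (Fintype.card Θ) δ < sqErr m I Y t ω θ' - sqErr m I Y t ω (θhat t ω)

/-- The first time `t ≥ 1` that is a multiple of `r` and passes the stopping test, `⊤` if there is
none: the test is made every round for `r = 1`, and only at the ends of batches for `r = B`. -/
def stopTime [Fintype Θ] (m : Fin n → Θ → ℝ) (δ : ℝ) (I : ℕ → Ω → Fin n) (Y : ℕ → Ω → ℝ)
    (θhat : ℕ → Ω → Θ) (r : ℕ) (ω : Ω) : ℕ∞ :=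
  ⨅ (t : ℕ) (_ : 1 ≤ t ∧ r ∣ t ∧ StopTest m δ I Y θhat t ω), (t : ℕ∞)

/-- The quantity inside the `O(·)`, for given values of all the parameters. -/
def rate (B J η δ C D₀ D₁ : ℝ) : ℝ :=
  B + η * Real.log C * Real.log J / D₁ + Real.log (J / δ) / D₀
    + B * J * C ^ (1 / η) * δ ^ (D₀ / η ^ 2)

end BatchGCS

end

open MeasureTheory
open scoped ENNReal

namespace BatchGCS

/-! For an alternative `θ`, follow its excess squared error over the truth. By Hoeffding's lemma,
`exp (-excess / η)` loses in conditional mean a factor at most `1 - gap² / (4η)` at each pull;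
averaging over the arm turns the gap into a drift known at the end of the previous batch. Hence `exp
(logPotential)` is a supermartingale of mean at most `1`, and Markov with a union bound makes a
potential above `x` have probability at most `J * exp (-x)` at each fixed time
(`measure_exists_le_logPotential_le`).

The rest counts batch ends. Testing at batch ends stops by the first end at which every excess is
above the threshold, so the stopping time is at most `B` times the number of failing ends
(`stopTime_le_tsum`). Such an end is of one of two kinds (`tsum_indicator_fail_le`). Either more
than half of the earlier ends fail at level `0`, which happens at most twice as often as failure at
level `0` itself; or the estimate was right at half of them, the drift was `D₀` there, and a
potential is large. Failure at level `0` is rare because the drift is at least `D₁` after the first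
batch. Exponential tails make both expected counts finite: the first costs `η log J / D₁`, the
second adds `log (J / δ) / D₀`. -/

/-! ### Summing exponential tails and counting times. -/

theorem tsum_le_of_le_one_of_le_exp {f : ℕ → ℝ≥0∞} {M a : ℝ} (hM : 1 ≤ M) (ha : 0 < a)
    (h1 : ∀ k, f k ≤ 1) (h2 : ∀ k : ℕ, f k ≤ ENNReal.ofReal (M * Real.exp (-(a * k)))) :
    ∑' k, f k ≤ ENNReal.ofReal (Real.log M / a + 2 + 1 / a) := by
  have hlog : 0 ≤ Real.log M / a := div_nonneg (Real.log_nonneg hM) ha.le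
  -- Cut where the exponential bound drops below `1`: earlier terms count `1` each, and from there
  -- on a geometric series of ratio `exp (-a)` dominates.
  obtain ⟨m, hm, hm'⟩ : ∃ m : ℕ, (m : ℝ) ≤ Real.log M / a + 1 ∧ Real.log M ≤ a * m :=
    ⟨_, (Nat.ceil_lt_add_one hlog).le, (div_le_iff₀' ha).1 (Nat.le_ceil _)⟩
  obtain ⟨r, hr⟩ : ∃ r, r = Real.exp (-a) := ⟨_, rfl⟩
  have hr0 : 0 ≤ r := hr ▸ (Real.exp_pos _).le
  have hr1 : r < 1 := by simpa [hr] using ha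
  have hgeo : (1 - r)⁻¹ ≤ 1 + 1 / a := by
    have h : 1 + a ≤ Real.exp a := by linarith [Real.add_one_le_exp a]
    have hr' : r ≤ 1 / (1 + a) := by
      rw [show r = 1 / Real.exp a by simp [hr, Real.exp_neg]]
      exact one_div_le_one_div_of_le (by linarith) h
    have : a / (1 + a) ≤ 1 - r := by
      have : a / (1 + a) = 1 - 1 / (1 + a) := by field_simp; ring
      linarith
    calc (1 - r)⁻¹ ≤ (a / (1 + a))⁻¹ := inv_anti₀ (by positivity) this
      _ = 1 + 1 / a := by field_simp; ring
  have htail : ∀ k : ℕ, f (k + m) ≤ ENNReal.ofReal (r ^ k) := by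
    intro k
    refine (h2 _).trans (ENNReal.ofReal_le_ofReal ?_)
    calc M * Real.exp (-(a * (k + m : ℕ)))
        = Real.exp (Real.log M + -(a * (k + m : ℕ))) := by
          rw [Real.exp_add, Real.exp_log (by linarith)]
      _ ≤ Real.exp (k * -a) := by
          apply Real.exp_le_exp.2
          push_cast
          linarith
      _ = r ^ k := by rw [hr, Real.exp_nat_mul]
  have hhead : ∑ i ∈ Finset.range m, f i ≤ ENNReal.ofReal m :=
    (Finset.sum_le_sum fun i _ => h1 i).trans (by simp)
  have htail' : ∑' i, f (i + m) ≤ ENNReal.ofReal (1 - r)⁻¹ := by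
    rw [← tsum_geometric_of_lt_one hr0 hr1, ENNReal.ofReal_tsum_of_nonneg
      (fun k => pow_nonneg hr0 k) (summable_geometric_of_lt_one hr0 hr1)]
    exact ENNReal.tsum_le_tsum htail
  have hinv : 0 ≤ (1 - r)⁻¹ := inv_nonneg.2 (by linarith)
  have hsplit : ∑ i ∈ Finset.range m, f i + ∑' i, f (i + m) = ∑' i, f i :=
    ENNReal.summable.sum_add_tsum_nat_add'
  rw [← hsplit]
  refine (add_le_add hhead htail').trans ?_
  rw [← ENNReal.ofReal_add (Nat.cast_nonneg m) hinv]
  exact ENNReal.ofReal_le_ofReal (by linarith)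

open Classical in
theorem sum_range_ite_lt_two_mul_count_le (s : ℕ → Prop) (N : ℕ) :
    ∑ k ∈ Finset.range N, (if k < 2 * Nat.count s k then 1 else 0) ≤ 2 * Nat.count s N := by
  induction N with
  | zero => simp
  | succ N ih =>
    have hmono : Nat.count s N ≤ Nat.count s (N + 1) := Nat.count_monotone s (Nat.le_succ N)
    rw [Finset.sum_range_succ]
    split_ifs with h
    -- If `N` itself is counted, the trivial bound `N + 1` on the left side is already at most `2 *
    -- Nat.count s N`.
    · have : ∑ k ∈ Finset.range N, (if k < 2 * Nat.count s k then 1 else 0) ≤ N := by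
        calc _ ≤ ∑ k ∈ Finset.range N, 1 := Finset.sum_le_sum fun k _ => by split_ifs <;> simp
          _ = N := by simp
      omega
    · omega

open Classical in
/-- The times at which more than half of the previous times lie in `s` are at most twice as many
as the elements of `s`. -/
theorem tsum_ite_lt_two_mul_count_le (s : ℕ → Prop) :
    ∑' k, (if k < 2 * Nat.count s k then 1 else 0 : ℝ≥0∞)
      ≤ 2 * ∑' k, (if s k then 1 else 0 : ℝ≥0∞) := by
  rw [ENNReal.tsum_eq_iSup_nat]
  refine iSup_le fun N => ?_
  have h := sum_range_ite_lt_two_mul_count_le s N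
  calc ∑ k ∈ Finset.range N, (if k < 2 * Nat.count s k then 1 else 0 : ℝ≥0∞)
      = ((∑ k ∈ Finset.range N, (if k < 2 * Nat.count s k then 1 else 0) : ℕ) : ℝ≥0∞) := by
        push_cast; rfl
    _ ≤ ((2 * Nat.count s N : ℕ) : ℝ≥0∞) := by exact_mod_cast h
    _ = 2 * ∑ k ∈ Finset.range N, (if s k then 1 else 0 : ℝ≥0∞) := by
        rw [Nat.count_eq_card_filter_range, Finset.card_filter]
        push_cast
        rfl
    _ ≤ _ := by gcongr; exact ENNReal.sum_le_tsum _

theorem sum_range_mul_div (f : ℕ → ℝ) {B : ℕ} (hB : 0 < B) (k : ℕ) :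
    ∑ s ∈ Finset.range (B * k), f (s / B) = B * ∑ j ∈ Finset.range k, f j := by
  induction k with
  | zero => simp
  | succ k ih =>
    rw [Nat.mul_succ, Finset.sum_range_add, ih, Finset.sum_range_succ, mul_add]
    congr 1
    rw [Finset.sum_congr rfl (g := fun _ => f k)]
    · simp
    · intro x hx
      rw [Nat.mul_add_div hB, Nat.div_eq_of_lt (Finset.mem_range.1 hx), add_zero]

/-! ### The one-step estimate. -/

/-- A joint conditional law `w ⊗ ν` on an event `E` allows to integrate out the reward. -/
theorem setLIntegral_mul_comp_of_condExp {Ω : Type*} {m mΩ : MeasurableSpace Ω} {P : Measure Ω}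
    [IsProbabilityMeasure P] (hm : m ≤ mΩ) {E : Set Ω} (hE : MeasurableSet E) {Y : Ω → ℝ}
    (hY : Measurable Y) {w : Ω → ℝ} (hw : ∀ ω, 0 ≤ w ω) (hwm : Measurable w) {ν : Measure ℝ}
    [IsProbabilityMeasure ν]
    (h : ∀ A, MeasurableSet A →
      P[(E ∩ Y ⁻¹' A).indicator (fun _ => (1 : ℝ)) | m] =ᵐ[P] fun ω => w ω * ν.real A)
    {G : Ω → ℝ≥0∞} (hG : Measurable[m] G) {f : ℝ → ℝ≥0∞} (hf : Measurable f) :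
    ∫⁻ ω in E, G ω * f (Y ω) ∂P
      = (∫⁻ ω, G ω * ENNReal.ofReal (w ω) ∂P) * ∫⁻ y, f y ∂ν := by
  -- Taking `A` to be everything shows that `w` is a version of a conditional expectation.
  have hwi : Integrable w P := by
    have := (integrable_condExp (m := m) (μ := P)).congr (h Set.univ MeasurableSet.univ)
    simpa using this
  have hset : ∀ S, MeasurableSet[m] S → ∀ A, MeasurableSet A →
      P (S ∩ (E ∩ Y ⁻¹' A)) = (∫⁻ ω in S, ENNReal.ofReal (w ω) ∂P) * ν A := by
    intro S hS A hA
    have hEA : MeasurableSet (E ∩ Y ⁻¹' A) := hE.inter (hY hA)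
    have hint : Integrable ((E ∩ Y ⁻¹' A).indicator (fun _ => (1 : ℝ))) P :=
      (integrable_const 1).indicator hEA
    have h1 := setIntegral_condExp hm hint hS
    rw [setIntegral_congr_ae (hm _ hS) ((h A hA).mono fun ω hω _ => hω), integral_mul_const,
      setIntegral_indicator hEA, setIntegral_const, smul_eq_mul, mul_one] at h1
    rw [← ofReal_measureReal (s := S ∩ _), ← h1, ENNReal.ofReal_mul
      (integral_nonneg hw), ofReal_measureReal,
      ofReal_integral_eq_lintegral_ofReal hwi.integrableOn (Filter.Eventually.of_forall hw)]
  have hmap : ∀ S, MeasurableSet[m] S →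
      ∫⁻ ω in S ∩ E, f (Y ω) ∂P = (∫⁻ ω in S, ENNReal.ofReal (w ω) ∂P) * ∫⁻ y, f y ∂ν := by
    intro S hS
    have : (P.restrict (S ∩ E)).map Y = (∫⁻ ω in S, ENNReal.ofReal (w ω) ∂P) • ν := by
      ext A hA
      rw [Measure.map_apply hY hA, Measure.restrict_apply (hY hA), Measure.smul_apply,
        smul_eq_mul, ← hset S hS A hA]
      congr 1
      ext ω
      simp only [Set.mem_inter_iff]
      tauto
    rw [← lintegral_map hf hY, this, lintegral_smul_measure, smul_eq_mul]
  have hfY : Measurable fun ω => f (Y ω) := hf.comp hY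
  have hw' : Measurable fun ω => ENNReal.ofReal (w ω) := hwm.ennreal_ofReal
  -- The two weighted measures agree only on `m`; this suffices, since `G` is `m`-measurable and
  -- integrates the same against the trimmed measures.
  have htrim : ((P.restrict E).withDensity fun ω => f (Y ω)).trim hm
      = (∫⁻ y, f y ∂ν) • (P.withDensity fun ω => ENNReal.ofReal (w ω)).trim hm := by
    refine @Measure.ext _ m _ _ fun S hS => ?_
    rw [trim_measurableSet_eq hm hS, Measure.smul_apply, trim_measurableSet_eq hm hS,
      withDensity_apply _ (hm _ hS), withDensity_apply _ (hm _ hS),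
      Measure.restrict_restrict (hm _ hS), hmap S hS, smul_eq_mul, mul_comm]
  have hG' : Measurable G := hG.mono hm le_rfl
  have := congrArg (fun μ => ∫⁻ ω, G ω ∂μ) htrim
  simp only [lintegral_smul_measure, lintegral_trim hm hG, smul_eq_mul] at this
  rw [lintegral_withDensity_eq_lintegral_mul _ hfY hG',
    lintegral_withDensity_eq_lintegral_mul _ hw' hG'] at this
  simp only [Pi.mul_apply] at this
  rw [mul_comm (∫⁻ ω, G ω * _ ∂P)]
  simpa only [mul_comm (G _)] using this

theorem mean_mem_Icc {ν : Measure ℝ} [IsProbabilityMeasure ν] {a b : ℝ}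
    (hν : ∀ᵐ y ∂ν, y ∈ Set.Icc a b) : ∫ y, y ∂ν ∈ Set.Icc a b := by
  have hinteg : Integrable (fun y : ℝ => y) ν :=
    Integrable.of_mem_Icc _ _ measurable_id.aemeasurable hν
  constructor
  · calc a = ∫ _, a ∂ν := by simp
      _ ≤ _ := integral_mono_ae (integrable_const _) hinteg (hν.mono fun y hy => hy.1)
  · calc _ ≤ ∫ _, b ∂ν :=
          integral_mono_ae hinteg (integrable_const _) (hν.mono fun y hy => hy.2)
      _ = b := by simp

/-- The exponential moment at `-1 / η` of the excess squared error of the mean `b` over the mean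
`a` of a reward in an interval of length `√η`. -/
theorem lintegral_exp_sqErr_le {ν : Measure ℝ} [IsProbabilityMeasure ν] {η : ℝ} (hη : 0 < η)
    (hν : ∀ᵐ y ∂ν, y ∈ Set.Icc (-(√η / 2)) (√η / 2)) {b : ℝ}
    (hb : b ∈ Set.Icc (-(√η / 2)) (√η / 2)) :
    ∫⁻ y, ENNReal.ofReal (Real.exp (-((y - b) ^ 2 - (y - ∫ x, x ∂ν) ^ 2) / η)) ∂ν
      ≤ ENNReal.ofReal (1 - (b - ∫ x, x ∂ν) ^ 2 / (4 * η)) := by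
  set a := ∫ x, x ∂ν
  have hsq : √η ^ 2 = η := Real.sq_sqrt hη.le
  have ha : a ∈ Set.Icc (-(√η / 2)) (√η / 2) := mean_mem_Icc hν
  have hd : (b - a) ^ 2 ≤ η := by
    rw [← hsq]
    exact sq_le_sq' (by linarith [ha.1, ha.2, hb.1, hb.2]) (by linarith [ha.1, ha.2, hb.1, hb.2])
  have hG := ProbabilityTheory.hasSubgaussianMGF_of_mem_Icc (μ := ν) (X := fun y => y)
    measurable_id.aemeasurable hν
  have hmgf := hG.mgf_le (2 * (b - a) / η)
  have hint := hG.integrable_exp_mul (2 * (b - a) / η)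
  have hx : (b - a) ^ 2 / η ≤ 1 := (div_le_one hη).2 hd
  have hx0 : 0 ≤ (b - a) ^ 2 / η := by positivity
  set x := (b - a) ^ 2 / η
  -- The quadratic terms in `y` cancel, so this is a moment generating function at `2 * (b - a) /
  -- η`. The variance proxy `η / 4` then gives back only half of the gain `x`.
  have key : ∀ y, Real.exp (-((y - b) ^ 2 - (y - a) ^ 2) / η)
      = Real.exp (-x) * Real.exp (2 * (b - a) / η * (y - a)) := by
    intro y
    rw [← Real.exp_add]
    congr 1
    simp only [x]
    field_simp
    ring
  simp_rw [key]
  rw [← ofReal_integral_eq_lintegral_ofReal (hint.const_mul _)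
    (Filter.Eventually.of_forall fun y => by positivity), integral_const_mul]
  apply ENNReal.ofReal_le_ofReal
  change Real.exp (-x) * ProbabilityTheory.mgf (fun y => y - a) ν (2 * (b - a) / η) ≤ _
  have hvar : ((‖√η / 2 - -(√η / 2)‖₊ / 2 : NNReal) ^ 2 : NNReal) * (2 * (b - a) / η) ^ 2 / 2
      = x / 2 := by
    push_cast
    rw [show √η / 2 - -(√η / 2) = √η by ring, Real.norm_of_nonneg (Real.sqrt_nonneg _),
      div_pow, hsq]
    simp only [x]
    field_simp
  -- A bound affine in the squared gap can be averaged over the random arm.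
  have hexp : Real.exp (-(x / 2)) ≤ 1 - x / 4 := by
    rw [Real.exp_neg]
    calc (Real.exp (x / 2))⁻¹ ≤ (x / 2 + 1)⁻¹ :=
          inv_anti₀ (by linarith) (Real.add_one_le_exp _)
      _ ≤ 1 - x / 4 := by
          rw [inv_le_iff_one_le_mul₀ (by linarith)]
          nlinarith
  calc _ ≤ Real.exp (-x) * Real.exp (x / 2) := by
        gcongr
        refine hmgf.trans (le_of_eq ?_)
        rw [← hvar]
    _ = Real.exp (-(x / 2)) := by rw [← Real.exp_add]; congr 1; ring
    _ ≤ 1 - x / 4 := hexp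
    _ = _ := by simp only [x]; ring

/-! ### Verification values and the separation constant. -/

section Drift

variable {n : ℕ} {Θ : Type*}

theorem IsVerifProportion.D₀_eq {m : Fin n → Θ → ℝ} {θs : Θ} {w : Fin n → ℝ}
    (h : IsVerifProportion m θs w) : D₀ m θs = verifValue m θs w := by
  have : Nonempty (stdSimplex ℝ (Fin n)) := ⟨⟨w, h.1⟩⟩
  refine le_antisymm (ciSup_le fun w' => h.2 w' w'.2) ?_
  exact le_ciSup (f := fun w' : stdSimplex ℝ (Fin n) => verifValue m θs w')
    ⟨_, by rintro _ ⟨w', rfl⟩; exact h.2 w' w'.2⟩ ⟨w, h.1⟩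

variable [Fintype Θ]

theorem verifValue_le (m : Fin n → Θ → ℝ) {θs θ : Θ} (hθ : θ ≠ θs) (w : Fin n → ℝ) :
    verifValue m θs w ≤ ∑ i, w i * (m i θ - m i θs) ^ 2 :=
  ciInf_le (Set.finite_range fun θ' : {θ' : Θ // θ' ≠ θs} =>
    ∑ i, w i * (m i θ' - m i θs) ^ 2).bddBelow ⟨θ, hθ⟩

theorem D₁_le (m : Fin n → Θ → ℝ) (p : Θ → Fin n → ℝ) (θs θ : Θ) :
    D₁ m p θs ≤ verifValue m θs (p θ) :=
  ciInf_le (Set.finite_range fun θ => verifValue m θs (p θ)).bddBelow θ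

theorem η₀_le (m : Fin n → Θ → ℝ) (i : Fin n) {θ θ' : Θ} (h : θ ≠ θ') :
    η₀ m ≤ (m i θ - m i θ') ^ 2 :=
  (ciInf_le (Set.finite_range _).bddBelow i).trans
    (ciInf_le (Set.finite_range fun x : {x : Θ × Θ // x.1 ≠ x.2} =>
      (m i x.1.1 - m i x.1.2) ^ 2).bddBelow ⟨(θ, θ'), h⟩)

theorem η₀_le_verifValue [Nontrivial Θ] (m : Fin n → Θ → ℝ) (θs : Θ) {w : Fin n → ℝ}
    (hw : w ∈ stdSimplex ℝ (Fin n)) : η₀ m ≤ verifValue m θs w := by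
  obtain ⟨θ₁, hθ₁⟩ := exists_ne θs
  have : Nonempty {θ' : Θ // θ' ≠ θs} := ⟨⟨θ₁, hθ₁⟩⟩
  refine le_ciInf fun θ => ?_
  calc η₀ m = ∑ i, w i * η₀ m := by rw [← Finset.sum_mul, hw.2, one_mul]
    _ ≤ _ := Finset.sum_le_sum fun i _ => mul_le_mul_of_nonneg_left (η₀_le m i θ.2) (hw.1 i)

/-- Since every arm separates every pair, any sampling law has drift at least `η₀`, even one chosen
for a wrong estimate. This is what makes `D₁` positive. -/
theorem η₀_le_D₁ [Nontrivial Θ] (m : Fin n → Θ → ℝ) (θs : Θ) {p : Θ → Fin n → ℝ}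
    (hp : ∀ θ, p θ ∈ stdSimplex ℝ (Fin n)) : η₀ m ≤ D₁ m p θs :=
  le_ciInf fun θ => η₀_le_verifValue m θs (hp θ)

end Drift

/-! ### The exponential supermartingale. -/

section Run

variable {n : ℕ} {Θ Ω : Type*}

/-- The verification value of the sampling law in batch `j`, set to `0` in the first batch. -/
noncomputable def batchDrift (m : Fin n → Θ → ℝ) (θs : Θ) (p : Θ → Fin n → ℝ) (B : ℕ)
    (θhat : ℕ → Ω → Θ) (j : ℕ) (ω : Ω) : ℝ :=
  if j = 0 then 0 else verifValue m θs (p (θhat (B * j) ω))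

/-- The sum of squared errors of `θ` in excess of that of `θs`. -/
noncomputable def excess (m : Fin n → Θ → ℝ) (θs : Θ) (I : ℕ → Ω → Fin n) (Y : ℕ → Ω → ℝ)
    (t : ℕ) (ω : Ω) (θ : Θ) : ℝ :=
  sqErr m I Y t ω θ - sqErr m I Y t ω θs

/-- The logarithm of a nonnegative supermartingale: the excess of `θ`, compensated by its drift. -/
noncomputable def logPotential (m : Fin n → Θ → ℝ) (θs : Θ) (p : Θ → Fin n → ℝ) (B : ℕ) (η : ℝ)
    (I : ℕ → Ω → Fin n) (Y : ℕ → Ω → ℝ) (θhat : ℕ → Ω → Θ) (t : ℕ) (θ : Θ) (ω : Ω) : ℝ :=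
  ((∑ s ∈ Finset.range t, batchDrift m θs p B θhat (s / B) ω) / 4 - excess m θs I Y t ω θ) / η

variable {θs : Θ} {η : ℝ} {B : ℕ} {q : Fin n → ℝ} {p : Θ → Fin n → ℝ}
  {I : ℕ → Ω → Fin n} {Y : ℕ → Ω → ℝ} {θhat : ℕ → Ω → Θ}

theorem samplingLaw_mem (hq : q ∈ stdSimplex ℝ (Fin n)) (hp : ∀ θ, p θ ∈ stdSimplex ℝ (Fin n))
    (t : ℕ) (ω : Ω) : samplingLaw q p B θhat t ω ∈ stdSimplex ℝ (Fin n) := by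
  unfold samplingLaw
  split_ifs
  exacts [hq, hp _]

theorem logPotential_succ (m : Fin n → Θ → ℝ) (t : ℕ) (θ : Θ) (ω : Ω) :
    logPotential m θs p B η I Y θhat (t + 1) θ ω
      = logPotential m θs p B η I Y θhat t θ ω + batchDrift m θs p B θhat (t / B) ω / (4 * η)
        + -((Y (t + 1) ω - m (I (t + 1) ω) θ) ^ 2 - (Y (t + 1) ω - m (I (t + 1) ω) θs) ^ 2) / η := by
  simp only [logPotential, excess, sqErr, Finset.sum_range_succ,
    Finset.sum_Icc_succ_top (Nat.le_add_left 1 t)]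
  rw [← div_div]
  ring

/-- The value `0` in the first batch is a valid lower bound whatever the initial law is. -/
theorem batchDrift_le_sum [Fintype Θ] (m : Fin n → Θ → ℝ) (hB : 1 ≤ B) (hq : q ∈ stdSimplex ℝ (Fin n))
    {θ : Θ} (hθ : θ ≠ θs) (t : ℕ) (ω : Ω) :
    batchDrift m θs p B θhat (t / B) ω
      ≤ ∑ i, samplingLaw q p B θhat t ω i * (m i θ - m i θs) ^ 2 := by
  unfold batchDrift samplingLaw
  by_cases h : t < B
  · rw [if_pos (Nat.div_eq_of_lt h), if_pos h]
    exact Finset.sum_nonneg fun i _ => mul_nonneg (hq.1 i) (sq_nonneg _)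
  · rw [if_neg (Nat.div_pos (not_lt.1 h) hB).ne', if_neg h]
    exact verifValue_le m hθ _

variable {mΩ : MeasurableSpace Ω} {ν : Fin n → Θ → Measure ℝ} {P : Measure Ω}
  {𝓕 : Filtration ℕ mΩ}

theorem IsRun.measurable_sqErr (h : IsRun ν θs q p B P 𝓕 I Y θhat) (t : ℕ) (θ : Θ) :
    Measurable[𝓕 t] fun ω => sqErr (mean ν) I Y t ω θ := by
  refine Finset.measurable_fun_sum _ fun s hs => ?_
  obtain ⟨h1, h2⟩ := Finset.mem_Icc.1 hs
  have hI : Measurable[𝓕 t] (I s) :=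
    @measurable_to_countable' (Fin n) Ω _ _ (𝓕 t) _
      fun i => 𝓕.mono h2 _ (h.arm_adapted s h1 i)
  have hY : Measurable[𝓕 t] (Y s) := (h.reward_adapted s h1).mono (𝓕.mono h2) le_rfl
  exact (hY.sub ((measurable_of_countable fun i => mean ν i θ).comp hI)).pow_const 2

variable [Fintype Θ]

theorem IsRun.measurable_comp_estimate (h : IsRun ν θs q p B P 𝓕 I Y θhat) {s t : ℕ} (hs : 1 ≤ s)
    (hst : s ≤ t) (f : Θ → ℝ) : Measurable[𝓕 t] fun ω => f (θhat s ω) := by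
  let _ : MeasurableSpace Θ := ⊤
  have : Measurable[𝓕 t] (θhat s) :=
    @measurable_to_countable' Θ Ω _ _ (𝓕 t) _
      fun θ => 𝓕.mono hst _ (h.estimate_adapted s hs θ)
  exact (measurable_from_top (f := f)).comp this

theorem IsRun.measurable_batchDrift (h : IsRun ν θs q p B P 𝓕 I Y θhat) (hB : 1 ≤ B) {s t : ℕ}
    (hst : s ≤ t) : Measurable[𝓕 t] (batchDrift (mean ν) θs p B θhat (s / B)) := by
  unfold batchDrift
  split_ifs with h0
  · exact measurable_const
  · exact h.measurable_comp_estimate (Nat.mul_pos hB (Nat.pos_of_ne_zero h0))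
      ((Nat.mul_div_le s B).trans hst) fun θ => verifValue (mean ν) θs (p θ)

theorem IsRun.measurable_logPotential (h : IsRun ν θs q p B P 𝓕 I Y θhat) (hB : 1 ≤ B) (t : ℕ)
    (θ : Θ) : Measurable[𝓕 t] (logPotential (mean ν) θs p B η I Y θhat t θ) := by
  refine Measurable.div_const (Measurable.sub (Measurable.div_const ?_ _) ?_) _
  · exact Finset.measurable_fun_sum _ fun s hs =>
      h.measurable_batchDrift hB (Finset.mem_range.1 hs).le
  · exact (h.measurable_sqErr t θ).sub (h.measurable_sqErr t θs)

theorem IsRun.measurable_samplingLaw (h : IsRun ν θs q p B P 𝓕 I Y θhat) (hB : 1 ≤ B) (t : ℕ)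
    (i : Fin n) : Measurable[𝓕 t] fun ω => samplingLaw q p B θhat t ω i := by
  unfold samplingLaw
  split_ifs with h0
  · exact measurable_const
  · exact h.measurable_comp_estimate (Nat.mul_pos hB (Nat.div_pos (not_lt.1 h0) hB))
      (Nat.mul_div_le t B) fun θ => p θ i

/-- Given the past, the reward factor averages over arms to at most `1 - g / (4η) ≤ exp (-g /
(4η))`, where `g` is the drift of the current batch. This cancels the compensator exactly. -/
theorem IsRun.lintegral_exp_logPotential_succ_le [∀ i θ, IsProbabilityMeasure (ν i θ)]
    [IsProbabilityMeasure P]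
    (h : IsRun ν θs q p B P 𝓕 I Y θhat) (hη : 0 < η) (hB : 1 ≤ B)
    (hν : ∀ i θ, ∀ᵐ y ∂(ν i θ), y ∈ Set.Icc (-(√η / 2)) (√η / 2))
    (hq : q ∈ stdSimplex ℝ (Fin n)) (hp : ∀ θ, p θ ∈ stdSimplex ℝ (Fin n))
    {θ : Θ} (hθ : θ ≠ θs) (t : ℕ) :
    ∫⁻ ω, ENNReal.ofReal (Real.exp (logPotential (mean ν) θs p B η I Y θhat (t + 1) θ ω)) ∂P
      ≤ ∫⁻ ω, ENNReal.ofReal (Real.exp (logPotential (mean ν) θs p B η I Y θhat t θ ω)) ∂P := by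
  set m := mean ν with hm
  set Z := logPotential m θs p B η I Y θhat with hZ
  set g : Ω → ℝ := batchDrift m θs p B θhat (t / B) with hg
  set π : Ω → Fin n → ℝ := samplingLaw q p B θhat t with hπ
  have hπ0 : ∀ ω i, 0 ≤ π ω i := fun ω => (samplingLaw_mem hq hp t ω).1
  have hπ1 : ∀ ω, ∑ i, π ω i = 1 := fun ω => (samplingLaw_mem hq hp t ω).2
  have hπm : ∀ i, Measurable[𝓕 t] fun ω => π ω i := h.measurable_samplingLaw hB t
  have hgm : Measurable[𝓕 t] g := h.measurable_batchDrift hB le_rfl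
  have hZm : Measurable[𝓕 t] (Z t θ) := h.measurable_logPotential hB t θ
  set E : Fin n → Set Ω := fun i => {ω | I (t + 1) ω = i}
  have hE : ∀ i, MeasurableSet (E i) := fun i => 𝓕.le _ _ (h.arm_adapted (t + 1) (by omega) i)
  have hY : Measurable (Y (t + 1)) := (h.reward_adapted (t + 1) (by omega)).mono (𝓕.le _) le_rfl
  set f : Fin n → ℝ → ℝ≥0∞ := fun i y =>
    ENNReal.ofReal (Real.exp (-((y - m i θ) ^ 2 - (y - m i θs) ^ 2) / η))
  have hf : ∀ i, Measurable (f i) := fun i => by fun_prop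
  set G : Ω → ℝ≥0∞ := fun ω => ENNReal.ofReal (Real.exp (Z t θ ω + g ω / (4 * η)))
  have hG : Measurable[𝓕 t] G :=
    ((hZm.add (hgm.div_const _)).exp).ennreal_ofReal
  -- Splitting by the arm pulled leaves on each event a product of a past factor and a function of
  -- the new reward.
  have hstep : ∀ ω, ENNReal.ofReal (Real.exp (Z (t + 1) θ ω))
      = ∑ i, (E i).indicator (fun ω => G ω * f i (Y (t + 1) ω)) ω := by
    intro ω
    rw [Finset.sum_eq_single (I (t + 1) ω) _ (by simp)]
    · rw [Set.indicator_of_mem (show ω ∈ E (I (t + 1) ω) from rfl),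
        ← ENNReal.ofReal_mul (Real.exp_pos _).le, ← Real.exp_add, hZ, logPotential_succ]
    · intro i _ hi
      have hω : ω ∉ E i := fun hω => hi (Eq.symm hω)
      exact Set.indicator_of_notMem hω _
  have hmem : ∀ i θ, m i θ ∈ Set.Icc (-(√η / 2)) (√η / 2) := fun i θ => mean_mem_Icc (hν i θ)
  have hd : ∀ i, (m i θ - m i θs) ^ 2 / (4 * η) ≤ 1 := by
    intro i
    rw [div_le_one (by positivity)]
    have h1 := hmem i θ
    have h2 := hmem i θs
    calc (m i θ - m i θs) ^ 2 ≤ √η ^ 2 :=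
          sq_le_sq' (by linarith [h1.1, h2.2]) (by linarith [h1.2, h2.1])
      _ ≤ 4 * η := by rw [Real.sq_sqrt hη.le]; linarith
  have hterm : ∀ i, ∫⁻ ω in E i, G ω * f i (Y (t + 1) ω) ∂P
      ≤ ∫⁻ ω, G ω * ENNReal.ofReal (π ω i * (1 - (m i θ - m i θs) ^ 2 / (4 * η))) ∂P := by
    intro i
    rw [setLIntegral_mul_comp_of_condExp (𝓕.le t) (hE i) hY (fun ω => hπ0 ω i)
      ((hπm i).mono (𝓕.le t) le_rfl) (fun A hA => h.cond_law t i A hA) hG (hf i)]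
    refine (mul_le_mul_right (lintegral_exp_sqErr_le hη (hν i θs) (hmem i θ)) _).trans ?_
    rw [← lintegral_mul_const' _ _ ENNReal.ofReal_ne_top]
    refine lintegral_mono fun ω => ?_
    rw [mul_assoc, ← ENNReal.ofReal_mul (hπ0 ω i)]
    rfl
  calc ∫⁻ ω, ENNReal.ofReal (Real.exp (Z (t + 1) θ ω)) ∂P
      = ∑ i, ∫⁻ ω in E i, G ω * f i (Y (t + 1) ω) ∂P := by
        simp_rw [hstep]
        rw [lintegral_finsetSum]
        · exact Finset.sum_congr rfl fun i _ => lintegral_indicator (hE i) _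
        · exact fun i _ => ((hG.mono (𝓕.le t) le_rfl).mul ((hf i).comp hY)).indicator (hE i)
    _ ≤ ∑ i, ∫⁻ ω, G ω * ENNReal.ofReal (π ω i * (1 - (m i θ - m i θs) ^ 2 / (4 * η))) ∂P :=
        Finset.sum_le_sum fun i _ => hterm i
    _ = ∫⁻ ω, ∑ i, G ω * ENNReal.ofReal (π ω i * (1 - (m i θ - m i θs) ^ 2 / (4 * η))) ∂P := by
        rw [lintegral_finsetSum]
        exact fun i _ => (hG.mono (𝓕.le t) le_rfl).mul
          ((((hπm i).mono (𝓕.le t) le_rfl).mul_const _).ennreal_ofReal)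
    _ ≤ _ := by
        refine lintegral_mono fun ω => ?_
        rw [← Finset.mul_sum, ← ENNReal.ofReal_sum_of_nonneg
          (fun i _ => mul_nonneg (hπ0 ω i) (by linarith [hd i])),
          ← ENNReal.ofReal_mul (Real.exp_pos _).le]
        apply ENNReal.ofReal_le_ofReal
        have hsum : ∑ i, π ω i * (1 - (m i θ - m i θs) ^ 2 / (4 * η))
            ≤ 1 - g ω / (4 * η) := by
          have : ∑ i, π ω i * (1 - (m i θ - m i θs) ^ 2 / (4 * η))
              = 1 - (∑ i, π ω i * (m i θ - m i θs) ^ 2) / (4 * η) := by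
            simp_rw [mul_sub, mul_one, Finset.sum_sub_distrib, hπ1, ← mul_div_assoc,
              Finset.sum_div]
          rw [this]
          have := batchDrift_le_sum (p := p) (θhat := θhat) m hB hq hθ t ω
          gcongr
        calc _ ≤ Real.exp (Z t θ ω + g ω / (4 * η)) * Real.exp (-(g ω / (4 * η))) := by
              gcongr
              exact hsum.trans (Real.one_sub_le_exp_neg _)
          _ = Real.exp (Z t θ ω) := by rw [← Real.exp_add]; congr 1; ring

theorem IsRun.lintegral_exp_logPotential_le_one [∀ i θ, IsProbabilityMeasure (ν i θ)]
    [IsProbabilityMeasure P]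
    (h : IsRun ν θs q p B P 𝓕 I Y θhat) (hη : 0 < η) (hB : 1 ≤ B)
    (hν : ∀ i θ, ∀ᵐ y ∂(ν i θ), y ∈ Set.Icc (-(√η / 2)) (√η / 2))
    (hq : q ∈ stdSimplex ℝ (Fin n)) (hp : ∀ θ, p θ ∈ stdSimplex ℝ (Fin n))
    {θ : Θ} (hθ : θ ≠ θs) (t : ℕ) :
    ∫⁻ ω, ENNReal.ofReal (Real.exp (logPotential (mean ν) θs p B η I Y θhat t θ ω)) ∂P ≤ 1 := by
  induction t with
  | zero => simp [logPotential, excess, sqErr]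
  | succ t ih => exact (h.lintegral_exp_logPotential_succ_le hη hB hν hq hp hθ t).trans ih

/-- Markov's inequality at a fixed time and a union bound; no maximal inequality is needed, because
failures are counted one time at a time. -/
theorem IsRun.measure_exists_le_logPotential_le [∀ i θ, IsProbabilityMeasure (ν i θ)]
    [IsProbabilityMeasure P]
    (h : IsRun ν θs q p B P 𝓕 I Y θhat) (hη : 0 < η) (hB : 1 ≤ B)
    (hν : ∀ i θ, ∀ᵐ y ∂(ν i θ), y ∈ Set.Icc (-(√η / 2)) (√η / 2))
    (hq : q ∈ stdSimplex ℝ (Fin n)) (hp : ∀ θ, p θ ∈ stdSimplex ℝ (Fin n)) (t : ℕ) (x : ℝ) :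
    P {ω | ∃ θ, θ ≠ θs ∧ x ≤ logPotential (mean ν) θs p B η I Y θhat t θ ω}
      ≤ ENNReal.ofReal (Fintype.card Θ * Real.exp (-x)) := by
  have hle : ∀ θ, P {ω | θ ≠ θs ∧ x ≤ logPotential (mean ν) θs p B η I Y θhat t θ ω}
      ≤ ENNReal.ofReal (Real.exp (-x)) := by
    intro θ
    by_cases hθ : θ = θs
    · simp [hθ]
    have hm : Measurable fun ω =>
        ENNReal.ofReal (Real.exp (logPotential (mean ν) θs p B η I Y θhat t θ ω)) :=
      (((h.measurable_logPotential hB t θ).mono (𝓕.le t) le_rfl).exp).ennreal_ofReal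
    have hmk := mul_meas_ge_le_lintegral (μ := P) hm (ENNReal.ofReal (Real.exp x))
    have := hmk.trans (h.lintegral_exp_logPotential_le_one hη hB hν hq hp hθ t)
    rw [Real.exp_neg, ENNReal.ofReal_inv_of_pos (Real.exp_pos x)]
    rw [ENNReal.le_inv_iff_mul_le, mul_comm]
    refine (mul_le_mul_right (measure_mono ?_) _).trans this
    intro ω hω
    exact ENNReal.ofReal_le_ofReal (Real.exp_le_exp.2 hω.2)
  calc _ ≤ P (⋃ θ, {ω | θ ≠ θs ∧ x ≤ logPotential (mean ν) θs p B η I Y θhat t θ ω}) :=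
        measure_mono (by rintro ω ⟨θ, hω⟩; exact Set.mem_iUnion.2 ⟨θ, hω⟩)
    _ ≤ ∑ θ : Θ, ENNReal.ofReal (Real.exp (-x)) :=
        (measure_iUnion_fintype_le _ _).trans (Finset.sum_le_sum fun θ _ => hle θ)
    _ = _ := by
        rw [Finset.sum_const, Finset.card_univ, nsmul_eq_mul,
          ENNReal.ofReal_mul (Nat.cast_nonneg _), ENNReal.ofReal_natCast]

end Run

/-! ### Pathwise counting of failing batch ends. -/

/-- At the end of batch `k`, some alternative does not have an excess above `x`. -/
def fail {n : ℕ} {Θ Ω : Type*} (m : Fin n → Θ → ℝ) (θs : Θ) (B : ℕ) (I : ℕ → Ω → Fin n)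
    (Y : ℕ → Ω → ℝ) (x : ℝ) (k : ℕ) : Set Ω :=
  {ω | ∃ θ, θ ≠ θs ∧ excess m θs I Y (B * k) ω θ ≤ x}

section Pathwise

variable {n : ℕ} {Θ Ω : Type*} {m : Fin n → Θ → ℝ} {θs : Θ} {η : ℝ} {B : ℕ}
  {p : Θ → Fin n → ℝ} {I : ℕ → Ω → Fin n} {Y : ℕ → Ω → ℝ} {θhat : ℕ → Ω → Θ} {ω : Ω}

/-- All excesses vanish at time `0`. So a good batch end is never at time `0`, where the estimate is
unconstrained. -/
theorem mem_fail_zero [Nontrivial Θ] {x : ℝ} (hx : 0 ≤ x) : ω ∈ fail m θs B I Y x 0 := by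
  obtain ⟨θ, hθ⟩ := exists_ne θs
  exact ⟨θ, hθ, by simpa [excess, sqErr] using hx⟩

theorem estimate_eq_of_notMem_fail {k : ℕ} {x : ℝ} (hx : 0 ≤ x)
    (hmin : ∀ θ, sqErr m I Y (B * k) ω (θhat (B * k) ω) ≤ sqErr m I Y (B * k) ω θ)
    (h : ω ∉ fail m θs B I Y x k) : θhat (B * k) ω = θs := by
  by_contra hne
  exact h ⟨_, hne, (sub_nonpos.2 (hmin θs)).trans hx⟩

/-- At the first good batch end `k` the estimate is `θs` and the test passes, while all `k` earlier
ends failed. Without a good end the right side is infinite. -/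
theorem stopTime_le_tsum [Fintype Θ] [Nontrivial Θ] {δ : ℝ} (hB : 1 ≤ B)
    (hL : 0 ≤ threshold (Fintype.card Θ) δ)
    (hmin : ∀ t, 1 ≤ t → ∀ θ, sqErr m I Y t ω (θhat t ω) ≤ sqErr m I Y t ω θ) :
    (stopTime m δ I Y θhat B ω : ℝ≥0∞)
      ≤ B * ∑' k, (fail m θs B I Y (threshold (Fintype.card Θ) δ) k).indicator 1 ω := by
  classical
  by_cases hex : ∃ k, ω ∉ fail m θs B I Y (threshold (Fintype.card Θ) δ) k
  · obtain ⟨hk, hlt⟩ := And.intro (Nat.find_spec hex) (fun j => Nat.find_min hex (m := j))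
    set k := Nat.find hex
    have hk0 : k ≠ 0 := fun h0 => by
      rw [h0] at hk
      exact hk (mem_fail_zero hL)
    have hBk : 1 ≤ B * k := Nat.mul_pos hB (Nat.pos_of_ne_zero hk0)
    have hest : θhat (B * k) ω = θs := estimate_eq_of_notMem_fail hL (hmin _ hBk) hk
    have htest : StopTest m δ I Y θhat (B * k) ω := by
      intro θ hθ
      rw [hest] at hθ ⊢
      by_contra hcon
      exact hk ⟨θ, hθ, not_lt.1 hcon⟩
    have hle : stopTime m δ I Y θhat B ω ≤ ((B * k : ℕ) : ℕ∞) :=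
      iInf₂_le (B * k) ⟨hBk, Dvd.intro _ rfl, htest⟩
    calc (stopTime m δ I Y θhat B ω : ℝ≥0∞) ≤ (((B * k : ℕ) : ℕ∞) : ℝ≥0∞) := by
          exact ENat.toENNReal_mono hle
      _ = B * ∑ j ∈ Finset.range k, 1 := by simp
      _ = B * ∑ j ∈ Finset.range k,
            (fail m θs B I Y (threshold (Fintype.card Θ) δ) j).indicator 1 ω := by
          congr 1
          refine Finset.sum_congr rfl fun j hj => ?_
          rw [Set.indicator_of_mem (not_not.1 (hlt j (Finset.mem_range.1 hj)))]
          rfl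
      _ ≤ _ := by gcongr; exact ENNReal.sum_le_tsum _
  · push Not at hex
    have : ∑' k, (fail m θs B I Y (threshold (Fintype.card Θ) δ) k).indicator
        (1 : Ω → ℝ≥0∞) ω = ⊤ := by
      rw [tsum_congr fun k => Set.indicator_of_mem (hex k) _]
      exact ENNReal.tsum_const_eq_top_of_ne_zero one_ne_zero
    rw [this, ENNReal.mul_top (by exact_mod_cast (by omega : B ≠ 0))]
    exact le_top

theorem D₁_mul_le_sum_batchDrift [Fintype Θ] (h0 : 0 ≤ D₁ m p θs) (k : ℕ) :
    D₁ m p θs * (k - 1) ≤ ∑ j ∈ Finset.range k, batchDrift m θs p B θhat j ω := by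
  induction k with
  | zero => simpa using h0
  | succ k ih =>
    rw [Finset.sum_range_succ]
    by_cases hk : k = 0
    · simp [hk, batchDrift]
    · have := D₁_le m p θs (θhat (B * k) ω)
      rw [batchDrift, if_neg hk]
      push_cast
      linarith

open Classical in
-- After a good end the next batch samples from `p θs` and has drift `D₀`; after a bad one the drift
-- is still nonnegative. Index `0` counts as bad, which matches the zero drift of the first batch.
theorem D₀_mul_le_sum_batchDrift [Fintype Θ] [Nontrivial Θ] (hB : 1 ≤ B) (h0 : 0 ≤ D₁ m p θs)
    (hp : IsVerifProportion m θs (p θs))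
    (hmin : ∀ t, 1 ≤ t → ∀ θ, sqErr m I Y t ω (θhat t ω) ≤ sqErr m I Y t ω θ) (k : ℕ) :
    D₀ m θs * (k - Nat.count (fun j => ω ∈ fail m θs B I Y 0 j) k)
      ≤ ∑ j ∈ Finset.range k, batchDrift m θs p B θhat j ω := by
  induction k with
  | zero => simp
  | succ k ih =>
    rw [Finset.sum_range_succ, Nat.count_succ]
    by_cases hk : ω ∈ fail m θs B I Y 0 k
    · have : 0 ≤ batchDrift m θs p B θhat k ω := by
        unfold batchDrift
        split_ifs
        exacts [le_rfl, h0.trans (D₁_le m p θs _)]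
      rw [if_pos hk]
      push_cast
      linarith
    · have hk0 : k ≠ 0 := fun h => hk (h ▸ mem_fail_zero le_rfl)
      have hest : θhat (B * k) ω = θs := estimate_eq_of_notMem_fail le_rfl
        (hmin _ (Nat.mul_pos hB (Nat.pos_of_ne_zero hk0))) hk
      rw [if_neg hk, batchDrift, if_neg hk0, hest, ← hp.D₀_eq]
      push_cast
      linarith

theorem logPotential_mul (hB : 1 ≤ B) (k : ℕ) (θ : Θ) :
    logPotential m θs p B η I Y θhat (B * k) θ ω
      = (B * (∑ j ∈ Finset.range k, batchDrift m θs p B θhat j ω) / 4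
          - excess m θs I Y (B * k) ω θ) / η := by
  rw [logPotential, sum_range_mul_div (fun j => batchDrift m θs p B θhat j ω) hB]

/-- At the end of batch `k`, the potential of some alternative is as large as it must be if that
alternative has excess at most `x` and at least half of the estimates so far were correct. -/
def largePotential (m : Fin n → Θ → ℝ) (θs : Θ) (p : Θ → Fin n → ℝ) (B : ℕ) (η : ℝ)
    (I : ℕ → Ω → Fin n) (Y : ℕ → Ω → ℝ) (θhat : ℕ → Ω → Θ) (x : ℝ) (k : ℕ) : Set Ω :=
  {ω | ∃ θ, θ ≠ θs ∧
    (D₀ m θs * B * k / 8 - x) / η ≤ logPotential m θs p B η I Y θhat (B * k) θ ω}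

theorem fail_zero_subset [Fintype Θ] (hη : 0 < η) (hB : 1 ≤ B) (h0 : 0 ≤ D₁ m p θs) (k : ℕ) :
    fail m θs B I Y 0 k ⊆ {ω | ∃ θ, θ ≠ θs ∧
      D₁ m p θs * B / (4 * η) * (k - 1) ≤ logPotential m θs p B η I Y θhat (B * k) θ ω} := by
  rintro ω ⟨θ, hθ, hx⟩
  refine ⟨θ, hθ, ?_⟩
  have h := mul_le_mul_of_nonneg_left
    (D₁_mul_le_sum_batchDrift (B := B) (θhat := θhat) (ω := ω) h0 k) (Nat.cast_nonneg (α := ℝ) B)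
  rw [logPotential_mul hB, le_div_iff₀ hη]
  calc D₁ m p θs * B / (4 * η) * (k - 1) * η = B * (D₁ m p θs * (k - 1)) / 4 := by
        field_simp
    _ ≤ _ := by linarith

/-- If at most half of the earlier ends were bad, the accumulated drift is at least `D₀ * k / 2`, so
an excess of at most `x` forces a large potential. Otherwise `k` is one of the times bounded by
`tsum_ite_lt_two_mul_count_le`. -/
theorem tsum_indicator_fail_le [Fintype Θ] [Nontrivial Θ] (hη : 0 < η) (hB : 1 ≤ B)
    (h0 : 0 ≤ D₁ m p θs) (hp : IsVerifProportion m θs (p θs))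
    (hmin : ∀ t, 1 ≤ t → ∀ θ, sqErr m I Y t ω (θhat t ω) ≤ sqErr m I Y t ω θ) (x : ℝ) :
    ∑' k, (fail m θs B I Y x k).indicator (1 : Ω → ℝ≥0∞) ω
      ≤ 2 * ∑' k, (fail m θs B I Y 0 k).indicator 1 ω
        + ∑' k, (largePotential m θs p B η I Y θhat x k).indicator 1 ω := by
  classical
  set c : ℕ → ℕ := Nat.count (fun j => ω ∈ fail m θs B I Y 0 j)
  have hD₀ : 0 ≤ D₀ m θs := hp.D₀_eq ▸ h0.trans (D₁_le m p θs θs)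
  have hterm : ∀ k, (fail m θs B I Y x k).indicator (1 : Ω → ℝ≥0∞) ω
      ≤ (if k < 2 * c k then 1 else 0)
        + (largePotential m θs p B η I Y θhat x k).indicator 1 ω := by
    intro k
    by_cases hk : ω ∈ fail m θs B I Y x k
    swap
    · simp [hk]
    rw [Set.indicator_of_mem hk]
    split_ifs with hc
    · exact le_self_add
    · obtain ⟨θ, hθ, hx⟩ := hk
      have hmem : ω ∈ largePotential m θs p B η I Y θhat x k := by
        refine ⟨θ, hθ, ?_⟩
        rw [logPotential_mul hB]
        have hsum := D₀_mul_le_sum_batchDrift hB h0 hp hmin k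
        have hck : (2 * c k : ℝ) ≤ k := by exact_mod_cast not_lt.1 hc
        have h1 : D₀ m θs * (k / 2) ≤ ∑ j ∈ Finset.range k, batchDrift m θs p B θhat j ω :=
          (mul_le_mul_of_nonneg_left (by linarith) hD₀).trans hsum
        have h2 := mul_le_mul_of_nonneg_left h1 (Nat.cast_nonneg (α := ℝ) B)
        exact div_le_div_of_nonneg_right (by linarith) hη.le
      rw [Set.indicator_of_mem hmem]
      exact le_add_self
  calc _ ≤ ∑' k, ((if k < 2 * c k then 1 else 0 : ℝ≥0∞)
        + (largePotential m θs p B η I Y θhat x k).indicator 1 ω) := ENNReal.tsum_le_tsum hterm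
    _ = ∑' k, (if k < 2 * c k then 1 else 0 : ℝ≥0∞)
        + ∑' k, (largePotential m θs p B η I Y θhat x k).indicator 1 ω := ENNReal.tsum_add
    _ ≤ _ := by
        gcongr
        refine (tsum_ite_lt_two_mul_count_le _).trans (le_of_eq ?_)
        simp only [Set.indicator_apply, Pi.one_apply]

end Pathwise

/-! ### Expected numbers of bad batch ends. -/

section Run

variable {n : ℕ} {Θ Ω : Type*} [Fintype Θ] {mΩ : MeasurableSpace Ω}
  {ν : Fin n → Θ → Measure ℝ} {θs : Θ} {η : ℝ} {B : ℕ} {q : Fin n → ℝ} {p : Θ → Fin n → ℝ}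
  {P : Measure Ω} {𝓕 : Filtration ℕ mΩ} {I : ℕ → Ω → Fin n} {Y : ℕ → Ω → ℝ}
  {θhat : ℕ → Ω → Θ}

theorem IsRun.measurableSet_fail (h : IsRun ν θs q p B P 𝓕 I Y θhat) (x : ℝ) (k : ℕ) :
    MeasurableSet (fail (mean ν) θs B I Y x k) := by
  rw [fail, Set.ofPred_exists]
  refine MeasurableSet.iUnion fun θ => (MeasurableSet.const _).inter ?_
  exact measurableSet_le (((h.measurable_sqErr _ θ).sub (h.measurable_sqErr _ θs)).mono
    (𝓕.le _) le_rfl) measurable_const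

theorem IsRun.measurableSet_largePotential (h : IsRun ν θs q p B P 𝓕 I Y θhat) (hB : 1 ≤ B)
    (x : ℝ) (k : ℕ) :
    MeasurableSet (largePotential (mean ν) θs p B η I Y θhat x k) := by
  rw [largePotential, Set.ofPred_exists]
  refine MeasurableSet.iUnion fun θ => (MeasurableSet.const _).inter ?_
  exact measurableSet_le measurable_const
    ((h.measurable_logPotential hB _ θ).mono (𝓕.le _) le_rfl)

theorem IsRun.tsum_measure_fail_le [Nontrivial Θ] [∀ i θ, IsProbabilityMeasure (ν i θ)]
    [IsProbabilityMeasure P] (h : IsRun ν θs q p B P 𝓕 I Y θhat) (hη : 0 < η) (hB : 1 ≤ B)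
    (hν : ∀ i θ, ∀ᵐ y ∂(ν i θ), y ∈ Set.Icc (-(√η / 2)) (√η / 2))
    (hq : q ∈ stdSimplex ℝ (Fin n)) (hp : ∀ θ, p θ ∈ stdSimplex ℝ (Fin n))
    (h0 : 0 < D₁ (mean ν) p θs) {a : ℝ} (ha : a = D₁ (mean ν) p θs * B / (4 * η)) :
    ∑' k, P (fail (mean ν) θs B I Y 0 k)
      ≤ ENNReal.ofReal ((Real.log (Fintype.card Θ) + a) / a + 2 + 1 / a) := by
  have hB' : (0 : ℝ) < B := by exact_mod_cast hB
  have ha0 : 0 < a := by rw [ha]; positivity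
  have hJ : (1 : ℝ) ≤ Fintype.card Θ := by exact_mod_cast Fintype.card_pos
  -- The factor `exp a` pays for the driftless first batch, that is, for `k - 1` in place of `k`.
  have hM : (1 : ℝ) ≤ Fintype.card Θ * Real.exp a :=
    one_le_mul_of_one_le_of_one_le hJ (Real.one_le_exp ha0.le)
  have hlog : Real.log (Fintype.card Θ * Real.exp a) = Real.log (Fintype.card Θ) + a := by
    rw [Real.log_mul (by positivity) (Real.exp_pos a).ne', Real.log_exp]
  rw [← hlog]
  refine tsum_le_of_le_one_of_le_exp hM ha0 (fun k => prob_le_one) fun k => ?_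
  refine (measure_mono (fail_zero_subset hη hB h0.le k)).trans
    ((h.measure_exists_le_logPotential_le hη hB hν hq hp _ _).trans (le_of_eq ?_))
  rw [← ha, mul_assoc, ← Real.exp_add]
  congr 3
  ring

theorem IsRun.tsum_measure_largePotential_le [Nontrivial Θ]
    [∀ i θ, IsProbabilityMeasure (ν i θ)]
    [IsProbabilityMeasure P] (h : IsRun ν θs q p B P 𝓕 I Y θhat) (hη : 0 < η) (hB : 1 ≤ B)
    (hν : ∀ i θ, ∀ᵐ y ∂(ν i θ), y ∈ Set.Icc (-(√η / 2)) (√η / 2))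
    (hq : q ∈ stdSimplex ℝ (Fin n)) (hp : ∀ θ, p θ ∈ stdSimplex ℝ (Fin n))
    (h0 : 0 < D₀ (mean ν) θs) {x : ℝ} (hx : 0 ≤ x) {a : ℝ}
    (ha : a = D₀ (mean ν) θs * B / (8 * η)) :
    ∑' k, P (largePotential (mean ν) θs p B η I Y θhat x k)
      ≤ ENNReal.ofReal ((Real.log (Fintype.card Θ) + x / η) / a + 2 + 1 / a) := by
  have hB' : (0 : ℝ) < B := by exact_mod_cast hB
  have ha0 : 0 < a := by rw [ha]; positivity
  have hJ : (1 : ℝ) ≤ Fintype.card Θ := by exact_mod_cast Fintype.card_pos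
  -- The level `x` enters through the prefactor, so its contribution to the count is only `(x / η) /
  -- a`.
  have hM : (1 : ℝ) ≤ Fintype.card Θ * Real.exp (x / η) :=
    one_le_mul_of_one_le_of_one_le hJ (Real.one_le_exp (by positivity))
  have hlog : Real.log (Fintype.card Θ * Real.exp (x / η))
      = Real.log (Fintype.card Θ) + x / η := by
    rw [Real.log_mul (by positivity) (Real.exp_pos _).ne', Real.log_exp]
  rw [← hlog]
  refine tsum_le_of_le_one_of_le_exp hM ha0 (fun k => prob_le_one) fun k => ?_
  refine (h.measure_exists_le_logPotential_le hη hB hν hq hp _ _).trans (le_of_eq ?_)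
  rw [mul_assoc (Fintype.card Θ : ℝ), ← Real.exp_add]
  congr 3
  rw [ha]
  field_simp
  ring

theorem IsRun.lintegral_stopTime_le [Nontrivial Θ] [∀ i θ, IsProbabilityMeasure (ν i θ)]
    [IsProbabilityMeasure P] (h : IsRun ν θs q p B P 𝓕 I Y θhat) (hη : 0 < η) (hB : 1 ≤ B)
    (hp : IsVerifProportion (mean ν) θs (p θs))
    (h0 : 0 ≤ D₁ (mean ν) p θs) {δ : ℝ} (hL : 0 ≤ threshold (Fintype.card Θ) δ) :
    ∫⁻ ω, (stopTime (mean ν) δ I Y θhat B ω : ℝ≥0∞) ∂P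
      ≤ B * (2 * ∑' k, P (fail (mean ν) θs B I Y 0 k) + ∑' k, P (largePotential (mean ν) θs p B η
          I Y θhat (threshold (Fintype.card Θ) δ) k)) := by
  have hmin : ∀ᵐ ω ∂P, ∀ t, 1 ≤ t → ∀ θ,
      sqErr (mean ν) I Y t ω (θhat t ω) ≤ sqErr (mean ν) I Y t ω θ :=
    ae_all_iff.2 fun t => Filter.eventually_imp_distrib_left.2 fun ht => h.estimate_min t ht
  have hfail := h.measurableSet_fail 0
  have hlarge := h.measurableSet_largePotential (η := η) hB (threshold (Fintype.card Θ) δ)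
  have hint : ∀ S : ℕ → Set Ω, (∀ k, MeasurableSet (S k)) →
      ∫⁻ ω, ∑' k, (S k).indicator (1 : Ω → ℝ≥0∞) ω ∂P = ∑' k, P (S k) := by
    intro S hS
    rw [lintegral_tsum fun k => (measurable_one.indicator (hS k)).aemeasurable]
    exact tsum_congr fun k => lintegral_indicator_one (hS k)
  rw [← hint _ hfail, ← hint _ hlarge,
    ← lintegral_const_mul' _ _ (by simp : (2 : ℝ≥0∞) ≠ ⊤), ← lintegral_add_left
      ((Measurable.tsum fun k => measurable_one.indicator (hfail k)).const_mul _),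
    ← lintegral_const_mul' _ _ (ENNReal.natCast_ne_top B)]
  refine lintegral_mono_ae (hmin.mono fun ω hω => ?_)
  exact (stopTime_le_tsum (θs := θs) hB hL hω).trans
    (mul_le_mul_right (tsum_indicator_fail_le hη hB h0 hp hω _) _)

end Run

/-! ### Constants and conclusion. -/

/-- The two `log J + 1` terms have coefficient `8` and each costs a factor `3`, whence `48`. Of `C`
only `log C ≥ 1` matters, and the last term of the rate is just nonnegative. -/
theorem mul_add_le_mul_rate {B J η δ C D₀ D₁ a b : ℝ} (hB : 0 < B) (hJ : 2 ≤ J) (hη : 0 < η)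
    (hδ : 0 < δ) (hL : 0 ≤ Real.log (J / δ)) (hC : 44 ≤ C) (hD₁ : 0 < D₁) (hD : D₁ ≤ D₀)
    (ha : a = D₁ * B / (4 * η)) (hb : b = D₀ * B / (8 * η)) :
    B * (2 * ((Real.log J + a) / a + 2 + 1 / a)
        + ((Real.log J + Real.log (J / δ) / η) / b + 2 + 1 / b))
      ≤ 48 * rate B J η δ C D₀ D₁ := by
  have hD₀ : 0 < D₀ := hD₁.trans_le hD
  have hlogJ : 1 / 2 ≤ Real.log J := by
    have := Real.log_le_log two_pos hJ
    linarith [Real.log_two_gt_d9]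
  have hlogC : 1 ≤ Real.log C := by
    rw [Real.le_log_iff_exp_le (by linarith)]
    linarith [Real.exp_one_lt_d9]
  have hC0 : 0 ≤ C ^ (1 / η) := Real.rpow_nonneg (by linarith) _
  have hδ0 : 0 ≤ δ ^ (D₀ / η ^ 2) := Real.rpow_nonneg hδ.le _
  have hlast : 0 ≤ B * J * C ^ (1 / η) * δ ^ (D₀ / η ^ 2) := by positivity
  have heq : B * (2 * ((Real.log J + a) / a + 2 + 1 / a)
        + ((Real.log J + Real.log (J / δ) / η) / b + 2 + 1 / b))
      = 8 * B + 8 * (η * (Real.log J + 1) / D₁) + 8 * (η * (Real.log J + 1) / D₀)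
        + 8 * (Real.log (J / δ) / D₀) := by
    subst ha hb
    field_simp
    ring
  have h1 : η * (Real.log J + 1) / D₁ ≤ 3 * (η * Real.log C * Real.log J / D₁) := by
    have h := mul_le_mul_of_nonneg_right hlogC (by linarith : 0 ≤ Real.log J)
    calc η * (Real.log J + 1) / D₁ ≤ η * (3 * (Real.log C * Real.log J)) / D₁ := by
          gcongr
          linarith
      _ = _ := by ring
  have h2 : η * (Real.log J + 1) / D₀ ≤ η * (Real.log J + 1) / D₁ := by
    have : 0 ≤ Real.log J + 1 := by linarith
    gcongr
  have h3 : 0 ≤ Real.log (J / δ) / D₀ := div_nonneg hL hD₀.le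
  rw [heq, rate]
  linarith

end BatchGCS

theorem proposition1 :
    ∃ K : ℝ, ∀ (n : ℕ) (Θ : Type*) [Fintype Θ] [Nontrivial Θ]
      (ν : Fin n → Θ → Measure ℝ) [∀ i θ, IsProbabilityMeasure (ν i θ)]
      (θs : Θ) (η δ : ℝ) (B : ℕ) (q : Fin n → ℝ) (p : Θ → Fin n → ℝ)
      (Ω : Type*) [mΩ : MeasurableSpace Ω] (P : Measure Ω) [IsProbabilityMeasure P]
      (𝓕 : Filtration ℕ mΩ)
      (I : ℕ → Ω → Fin n) (Y : ℕ → Ω → ℝ) (θhat : ℕ → Ω → Θ),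
      0 < η → 0 < δ → δ ≤ 1 → 1 ≤ B →
      -- rewards have bounded range under every hypothesis
      (∀ i θ, ∀ᵐ y ∂(ν i θ), y ∈ Set.Icc (-(√η / 2)) (√η / 2)) →
      -- the hypotheses are separated by every arm
      0 < BatchGCS.η₀ (BatchGCS.mean ν) →
      q ∈ stdSimplex ℝ (Fin n) →
      (∀ θ, BatchGCS.IsVerifProportion (BatchGCS.mean ν) θ (p θ)) →
      BatchGCS.IsRun ν θs q p B P 𝓕 I Y θhat →
      (∫⁻ ω, (BatchGCS.stopTime (BatchGCS.mean ν) δ I Y θhat 1 ω : ℝ≥0∞) ∂P ≤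
        ENNReal.ofReal (K * BatchGCS.rate B (Fintype.card Θ) η δ
          (BatchGCS.constC η (BatchGCS.η₀ (BatchGCS.mean ν)))
          (BatchGCS.D₀ (BatchGCS.mean ν) θs) (BatchGCS.D₁ (BatchGCS.mean ν) p θs))) ∧
      (∫⁻ ω, (BatchGCS.stopTime (BatchGCS.mean ν) δ I Y θhat B ω : ℝ≥0∞) ∂P ≤
        ENNReal.ofReal (K * BatchGCS.rate B (Fintype.card Θ) η δ
          (BatchGCS.constC η (BatchGCS.η₀ (BatchGCS.mean ν)))
          (BatchGCS.D₀ (BatchGCS.mean ν) θs) (BatchGCS.D₁ (BatchGCS.mean ν) p θs))) := by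
  refine ⟨48, ?_⟩
  intro n Θ _ _ ν _ θs η δ B q p Ω mΩ P _ 𝓕 I Y θhat hη hδ hδ1 hB hν hsep hq hp hrun
  have hps : ∀ θ, p θ ∈ stdSimplex ℝ (Fin n) := fun θ => (hp θ).1
  have hJ : (2 : ℝ) ≤ Fintype.card Θ := by
    exact_mod_cast Fintype.one_lt_card (α := Θ)
  have hL : 0 ≤ BatchGCS.threshold (Fintype.card Θ) δ :=
    Real.log_nonneg ((one_le_div hδ).2 (by linarith))
  have hD₁ : 0 < BatchGCS.D₁ (BatchGCS.mean ν) p θs :=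
    hsep.trans_le (BatchGCS.η₀_le_D₁ _ θs hps)
  have hD : BatchGCS.D₁ (BatchGCS.mean ν) p θs ≤ BatchGCS.D₀ (BatchGCS.mean ν) θs :=
    (hp θs).D₀_eq ▸ BatchGCS.D₁_le _ p θs θs
  have hD₀ := hD₁.trans_le hD
  have hB' : (0 : ℝ) < B := by exact_mod_cast hB
  have hJlog : 0 ≤ Real.log (Fintype.card Θ) := Real.log_nonneg (by linarith)
  obtain ⟨a, ha⟩ : ∃ a, a = BatchGCS.D₁ (BatchGCS.mean ν) p θs * B / (4 * η) := ⟨_, rfl⟩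
  obtain ⟨b, hb⟩ : ∃ b, b = BatchGCS.D₀ (BatchGCS.mean ν) θs * B / (8 * η) := ⟨_, rfl⟩
  have ha0 : 0 < a := by rw [ha]; positivity
  have hb0 : 0 < b := by rw [hb]; positivity
  have hbatch : ∫⁻ ω, (BatchGCS.stopTime (BatchGCS.mean ν) δ I Y θhat B ω : ℝ≥0∞) ∂P ≤
      ENNReal.ofReal (48 * BatchGCS.rate B (Fintype.card Θ) η δ
        (BatchGCS.constC η (BatchGCS.η₀ (BatchGCS.mean ν)))
        (BatchGCS.D₀ (BatchGCS.mean ν) θs) (BatchGCS.D₁ (BatchGCS.mean ν) p θs)) := by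
    refine (hrun.lintegral_stopTime_le hη hB (hp θs) hD₁.le hL).trans ?_
    refine le_trans ?_ (ENNReal.ofReal_le_ofReal (BatchGCS.mul_add_le_mul_rate hB' hJ hη hδ hL
      (le_add_of_nonneg_right (sq_nonneg _)) hD₁ hD ha hb))
    have hL' : 0 ≤ Real.log (Fintype.card Θ / δ) := hL
    rw [ENNReal.ofReal_mul hB'.le, ENNReal.ofReal_natCast,
      ENNReal.ofReal_add (by positivity) (by positivity), ENNReal.ofReal_mul two_pos.le,
      ENNReal.ofReal_ofNat]
    gcongr
    · exact hrun.tsum_measure_fail_le hη hB hν hq hps hD₁ ha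
    · exact hrun.tsum_measure_largePotential_le hη hB hν hq hps hD₀ hL hb
  -- Testing in every round can only stop earlier than testing at batch ends.
  refine ⟨(lintegral_mono fun ω => ?_).trans hbatch, hbatch⟩
  have hle : BatchGCS.stopTime (BatchGCS.mean ν) δ I Y θhat 1 ω
      ≤ BatchGCS.stopTime (BatchGCS.mean ν) δ I Y θhat B ω :=
    le_iInf₂ fun t ht => iInf₂_le t ⟨ht.1, one_dvd t, ht.2.2⟩
  exact ENat.toENNReal_mono hle
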